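/- For integers $a \le b$ write $[a,b]=\{a,a+1,\dots,b\}$ (empty if $a>b$) and $[n]=[1,n]$, and let $\binom{[n]}{r}$ be the family of all $r$-element subsets of $[n]$. A family $\mathcal{A}\subseteq\binom{[n]}{r}$ is intersecting if no two members of $\mathcal{A}$ are disjoint. It is left-compressed if, for all $i>j$ in $[n]$ and every $A\in\mathcal{A}$ with $i\in A$ and $j\notin A$, the set $(A\setminus\{i\})\cup\{j\}$ also belongs to $\mathcal{A}$ (that is, $\mathcal{A}$ is fixed by every $ij$-shift with $i>j$). An LCIF is a left-compressed intersecting family $\mathcal{A}\subseteq\binom{[n]}{r}$, and an MLCIF is an LCIF that is maximal under inclusion among all LCIFs. For $X\subseteq[n]$ let $\mathrm{hit}_X(\mathcal{A})=|\{A\in\mathcal{A}: A\cap X\neq\emptyset\}|$. An LCIF (respectively, an MLCIF) is optimal for $X$ if it maximises $\mathrm{hit}_X$ among all LCIFs (respectively, among all MLCIFs) in $\binom{[n]}{r}$. Let $\mathcal{S}=\{A\in\binom{[n]}{r}: 1\in A\}$ be the star at $1$, and for $t\in[n]$ let $$\mathcal{AHM}_t=\{A\in\mathcal{S}: A\cap[2,t]\neq\emptyset\}\cup\left\{A\in\tbinom{[n]}{r}: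 [2,t]\subseteq A\right\}.$$ Corollary 3.3. For every integer $r\ge 3$ there is an integer $N$ such that the following holds for every $n\ge N$ and every non-empty $X\subseteq[2,n]$, where $m=\max X$. (i) If $\mathcal{S}$ is not an optimal MLCIF for $X$, then the optimal LCIFs for $X$ are precisely the optimal MLCIFs for $X$. (ii) If $\mathcal{S}$ is an optimal MLCIF for $X$, then the optimal LCIFs for $X$ are precisely the LCIFs $\mathcal{A}$ with $\mathcal{AHM}_m\subseteq\mathcal{A}\subseteq\mathcal{S}$. -/

import Mathlib

open Finset

namespace LCIF

/-- The family of all `r`-element subsets of `[n] = {1, …, n}`. -/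
def layer (n r : ℕ) : Finset (Finset ℕ) := (Icc 1 n).powersetCard r

/-- A family of subsets of `[n]` is left-compressed if for all `i > j` in `[n]` it is fixed by the
`ij`-shift, which replaces each member `A` with `i ∈ A`, `j ∉ A` by `(A \ {i}) ∪ {j}` unless the
latter is already a member. This shift is the `UV`-compression along `{j}` and `{i}`. -/
def IsLeftCompressed (n : ℕ) (𝒜 : Finset (Finset ℕ)) : Prop :=
  ∀ i ∈ Icc 1 n, ∀ j ∈ Icc 1 n, j < i → UV.IsCompressed ({j} : Finset ℕ) {i} 𝒜

/-- `𝒜` is a left-compressed intersecting family (LCIF) of `r`-element subsets of `[n]`. -/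
structure IsLCIF (n r : ℕ) (𝒜 : Finset (Finset ℕ)) : Prop where
  subset_layer : 𝒜 ⊆ layer n r
  leftCompressed : IsLeftCompressed n 𝒜
  intersecting : (𝒜 : Set (Finset ℕ)).Intersecting

/-- `𝒜` is a maximal (with respect to inclusion) left-compressed intersecting family (MLCIF). -/
def IsMLCIF (n r : ℕ) (𝒜 : Finset (Finset ℕ)) : Prop := Maximal (IsLCIF n r) 𝒜

/-- The number of members of `𝒜` that meet `X`. -/
def hit (X : Finset ℕ) (𝒜 : Finset (Finset ℕ)) : ℕ := #{A ∈ 𝒜 | (A ∩ X).Nonempty}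

/-- `𝒜` is an LCIF that has maximum hitting with `X` among all LCIFs. -/
def IsOptimalLCIF (n r : ℕ) (X : Finset ℕ) (𝒜 : Finset (Finset ℕ)) : Prop :=
  IsLCIF n r 𝒜 ∧ ∀ ℱ, IsLCIF n r ℱ → hit X ℱ ≤ hit X 𝒜

/-- `𝒜` is an MLCIF that has maximum hitting with `X` among all MLCIFs. -/
def IsOptimalMLCIF (n r : ℕ) (X : Finset ℕ) (𝒜 : Finset (Finset ℕ)) : Prop :=
  IsMLCIF n r 𝒜 ∧ ∀ ℱ, IsMLCIF n r ℱ → hit X ℱ ≤ hit X 𝒜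

/-- The star at `1`: all `r`-element subsets of `[n]` that contain `1`. -/
def star (n r : ℕ) : Finset (Finset ℕ) := {A ∈ layer n r | 1 ∈ A}

/-- The `t`-adjusted Hilton–Milner family. -/
def AHM (n r t : ℕ) : Finset (Finset ℕ) :=
  {A ∈ star n r | (A ∩ Icc 2 t).Nonempty} ∪ {A ∈ layer n r | Icc 2 t ⊆ A}

end LCIF

/-!
Two members of a left-compressed intersecting family already meet inside `[2r]`, since otherwise
shifting would turn them into disjoint members. If the family is not contained in the star, every
trace on `[2r]` therefore has at least two elements, and for large `n` the number of members meeting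
`X` is governed, at leading order `(n - 2).choose (r - 2)`, by the number of two-element traces
meeting `X`. The star has one pair `{1, x}` for each `x ∈ X`, so an optimal family outside the star
must have at least `#X` such traces. Either `{2, 3}` is a trace, which confines the family to
`AHM n r 3`, or all two-element traces contain `1`; then `{1, m}` is a trace for `m = max X`, so
that each member without `1` contains `[2, m]`, which forces the family to be `AHM n r m`. In both
cases an adjusted Hilton–Milner family, which is maximal, strictly beats the star.

If the star itself is optimal, an optimal family thus lies in the star and contains all members of
the star that meet `X`; left-compression of those containing `m` then yields all of `AHM n r m`.
-/

namespace LCIF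

variable {n r k t : ℕ} {𝒜 ℬ : Finset (Finset ℕ)} {F X : Finset ℕ}

lemma mem_layer : F ∈ layer n r ↔ F ⊆ Icc 1 n ∧ #F = r := mem_powersetCard

lemma mem_star : F ∈ star n r ↔ F ∈ layer n r ∧ 1 ∈ F := mem_filter

lemma mem_AHM : F ∈ AHM n r t ↔
    F ∈ layer n r ∧ (1 ∈ F ∧ (∃ x ∈ F, x ∈ Icc 2 t) ∨ Icc 2 t ⊆ F) := by
  simp only [AHM, mem_union, mem_filter, mem_star, Finset.Nonempty, mem_inter, and_assoc,
    ← and_or_left]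

lemma mem_AHM_three : F ∈ AHM n r 3 ↔
    F ∈ layer n r ∧ (1 ∈ F ∧ 2 ∈ F ∨ 1 ∈ F ∧ 3 ∈ F ∨ 2 ∈ F ∧ 3 ∈ F) := by
  have hIcc : Icc 2 3 = ({2, 3} : Finset ℕ) := by decide
  simp only [mem_AHM, hIcc, insert_subset_iff, singleton_subset_iff, mem_insert, mem_singleton,
    and_or_left, exists_or, exists_eq_right, or_assoc]

lemma exists_mem_layer_superset_disjoint {P Q : Finset ℕ} (hP : P ⊆ Icc 1 n) (hPr : #P ≤ r)
    (hPQ : Disjoint P Q) (hn : r + #Q ≤ n) : ∃ W ∈ layer n r, P ⊆ W ∧ Disjoint W Q := by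
  have hr : r ≤ #(Icc 1 n \ Q) := by
    have := le_card_sdiff Q (Icc 1 n)
    rw [Nat.card_Icc] at this
    lia
  obtain ⟨W, hPW, hW, hWr⟩ := exists_subsuperset_card_eq (subset_sdiff.2 ⟨hP, hPQ⟩) hPr hr
  rw [subset_sdiff] at hW
  exact ⟨W, mem_layer.2 ⟨hW.1, hWr⟩, hPW, hW.2⟩

lemma insert_erase_mem_layer {i j : ℕ} (hF : F ∈ layer n r) (hj : j ∈ Icc 1 n) (hi : i ∈ F)
    (hjF : j ∉ F) : insert j (F.erase i) ∈ layer n r := by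
  rw [mem_layer] at hF ⊢
  refine ⟨insert_subset hj ((erase_subset _ _).trans hF.1), ?_⟩
  rw [card_insert_of_notMem (mt mem_of_mem_erase hjF), card_erase_add_one hi, hF.2]

lemma isCompressed_iff_forall_compress_mem {U V : Finset ℕ} :
    UV.IsCompressed U V 𝒜 ↔ ∀ F ∈ 𝒜, UV.compress U V F ∈ 𝒜 := by
  refine ⟨fun h F hF => h.eq ▸ UV.compress_mem_compression hF, fun h => ?_⟩
  ext F
  rw [UV.mem_compression]
  constructor
  · rintro (⟨hF, -⟩ | ⟨-, G, hG, rfl⟩)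
    exacts [hF, h G hG]
  · exact fun hF => Or.inl ⟨hF, h F hF⟩

lemma isLeftCompressed_iff (h𝒜 : 𝒜 ⊆ layer n r) : IsLeftCompressed n 𝒜 ↔
    ∀ F ∈ 𝒜, ∀ i ∈ F, ∀ j ∉ F, 1 ≤ j → j < i → insert j (F.erase i) ∈ 𝒜 := by
  have hcompress (i j : ℕ) (F : Finset ℕ) (hji : j < i) : UV.compress {j} {i} F =
      if j ∉ F ∧ i ∈ F then insert j (F.erase i) else F := by
    simp only [UV.compress, disjoint_singleton_left, singleton_subset_iff, sup_eq_union,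
      union_singleton, sdiff_singleton_eq_erase, erase_insert_of_ne hji.ne]
  have hle {F i} (hF : F ∈ 𝒜) (hi : i ∈ F) := mem_Icc.1 ((mem_layer.1 (h𝒜 hF)).1 hi)
  simp only [IsLeftCompressed, isCompressed_iff_forall_compress_mem]
  constructor
  · intro h F hF i hi j hj hj1 hji
    have := h i (mem_Icc.2 (hle hF hi)) j (mem_Icc.2 ⟨hj1, hji.le.trans (hle hF hi).2⟩) hji F hF
    rwa [hcompress i j F hji, if_pos ⟨hj, hi⟩] at this
  · intro h i _ j hj hji F hF
    rw [hcompress i j F hji]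
    split_ifs with hc
    exacts [h F hF i hc.2 j hc.1 (mem_Icc.1 hj).1 hji, hF]

section Shifting

lemma IsLCIF.insert_erase_mem (h : IsLCIF n r 𝒜) (hF : F ∈ 𝒜) {i j : ℕ} (hi : i ∈ F)
    (hj : j ∉ F) (hj1 : 1 ≤ j) (hji : j < i) : insert j (F.erase i) ∈ 𝒜 :=
  (isLeftCompressed_iff h.subset_layer).1 h.leftCompressed F hF i hi j hj hj1 hji

lemma IsLCIF.mem_of_insert_erase_mem (h : IsLCIF n r 𝒜) {i j : ℕ} (hi : i ∉ F) (hj : j ∈ F)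
    (hj1 : 1 ≤ j) (hji : j < i) (hF : insert i (F.erase j) ∈ 𝒜) : F ∈ 𝒜 := by
  have := h.insert_erase_mem hF (mem_insert_self i _) (by simp [hji.ne]) hj1 hji
  rwa [erase_insert (mt mem_of_mem_erase hi), insert_erase hj] at this

/-- The traces on `[k]` of the members of `𝒜`. -/
def traces (k : ℕ) (𝒜 : Finset (Finset ℕ)) : Finset (Finset ℕ) := 𝒜.image (· ∩ Icc 1 k)

lemma mem_traces {P : Finset ℕ} : P ∈ traces k 𝒜 ↔ ∃ F ∈ 𝒜, F ∩ Icc 1 k = P := mem_image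

lemma IsLCIF.mem_of_trace_subset (h : IsLCIF n r 𝒜) {W : Finset ℕ} (hF : F ∈ 𝒜)
    (hW : W ∈ layer k r) (hFW : F ∩ Icc 1 k ⊆ W) : W ∈ 𝒜 := by
  have hWF : #W = #F := (mem_layer.1 hW).2.trans (mem_layer.1 (h.subset_layer hF)).2.symm
  induction hd : #(W \ F) generalizing F with
  | zero =>
    rw [card_eq_zero, sdiff_eq_empty_iff_subset] at hd
    rwa [eq_of_subset_of_card_le hd hWF.ge]
  | succ d ih =>
    obtain ⟨j, hj⟩ : (W \ F).Nonempty := card_pos.1 (by lia)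
    obtain ⟨i, hi⟩ : (F \ W).Nonempty := card_pos.1 (by rw [← card_sdiff_comm hWF]; lia)
    rw [mem_sdiff] at hi hj
    have hjk := mem_Icc.1 ((mem_layer.1 hW).1 hj.1)
    have hi1 := (mem_Icc.1 ((mem_layer.1 (h.subset_layer hF)).1 hi.1)).1
    have hki : k < i := by
      by_contra! hik
      exact hi.2 (hFW (mem_inter.2 ⟨hi.1, mem_Icc.2 ⟨hi1, hik⟩⟩))
    have hF' := h.insert_erase_mem hF hi.1 hj.2 hjk.1 (hjk.2.trans_lt hki)
    have hdiff : W \ insert j (F.erase i) = (W \ F).erase j := by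
      ext x
      have : x ∈ W → x ≠ i := fun hx => ne_of_mem_of_not_mem hx hi.2
      simp only [mem_sdiff, mem_insert, mem_erase]
      tauto
    refine ih hF' (by grind) ?_ ?_
    · exact (mem_layer.1 hW).2.trans (mem_layer.1 (h.subset_layer hF')).2.symm
    · rw [hdiff, card_erase_of_mem (mem_sdiff.2 hj), hd, Nat.add_sub_cancel]

-- If the traces were disjoint, left-compression would allow both members to be replaced by
-- complementary `r`-sets inside `[2r]`.
lemma IsLCIF.not_disjoint_trace (h : IsLCIF n r 𝒜) {P G : Finset ℕ} (hP : P ∈ traces (2 * r) 𝒜)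
    (hG : G ∈ 𝒜) : ¬ Disjoint P G := by
  intro hPG
  obtain ⟨F, hF, rfl⟩ := mem_traces.1 hP
  have hFr := (mem_layer.1 (h.subset_layer hF)).2
  have hGr := (mem_layer.1 (h.subset_layer hG)).2
  obtain ⟨W, hW, hFW, hWG⟩ := exists_mem_layer_superset_disjoint (n := 2 * r) (r := r)
    inter_subset_right ((card_le_card inter_subset_left).trans hFr.le) hPG (by lia)
  have hW' : Icc 1 (2 * r) \ W ∈ layer (2 * r) r := by
    rw [mem_layer] at hW ⊢
    refine ⟨sdiff_subset, ?_⟩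
    rw [card_sdiff_of_subset hW.1, hW.2, Nat.card_Icc]
    lia
  have hGW : G ∩ Icc 1 (2 * r) ⊆ Icc 1 (2 * r) \ W :=
    subset_sdiff.2 ⟨inter_subset_right, hWG.symm.mono_left inter_subset_left⟩
  exact h.intersecting (h.mem_of_trace_subset hF hW hFW) (h.mem_of_trace_subset hG hW' hGW)
    disjoint_sdiff

lemma IsLCIF.insert_erase_mem_traces (h : IsLCIF n r 𝒜) {P : Finset ℕ} (hP : P ∈ traces k 𝒜)
    {i j : ℕ} (hi : i ∈ P) (hj : j ∉ P) (hj1 : 1 ≤ j) (hji : j < i) :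
    insert j (P.erase i) ∈ traces k 𝒜 := by
  obtain ⟨F, hF, rfl⟩ := mem_traces.1 hP
  rw [mem_inter, mem_Icc] at hi
  have hjk : j ∈ Icc 1 k := mem_Icc.2 ⟨hj1, hji.le.trans hi.2.2⟩
  refine mem_traces.2 ⟨_, h.insert_erase_mem hF hi.1 (fun hjF => hj (mem_inter.2 ⟨hjF, hjk⟩))
    hj1 hji, ?_⟩
  rw [insert_inter_of_mem hjk, erase_inter]

lemma IsLCIF.pair_mem_traces_of_le (h : IsLCIF n r 𝒜) {i j i' j' : ℕ} (hij : i < j)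
    (hP : {i, j} ∈ traces k 𝒜) (hi1 : 1 ≤ i') (hi : i' ≤ i) (hij' : i' < j') (hj : j' ≤ j) :
    {i', j'} ∈ traces k 𝒜 := by
  have hP' : {i', j} ∈ traces k 𝒜 := by
    obtain rfl | hlt := hi.eq_or_lt
    · exact hP
    · convert h.insert_erase_mem_traces hP (mem_insert_self i _) (j := i') (by grind) hi1 hlt
        using 1
      grind
  obtain rfl | hlt := hj.eq_or_lt
  · exact hP'
  · convert h.insert_erase_mem_traces hP' (i := j) (j := j') (by simp) (by grind) (by lia) hlt
      using 1
    grind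

lemma IsLCIF.two_le_card_of_mem_traces (h : IsLCIF n r 𝒜) (hS : ¬ 𝒜 ⊆ star n r) {P : Finset ℕ}
    (hP : P ∈ traces (2 * r) 𝒜) : 2 ≤ #P := by
  by_contra! hlt
  have hne : P.Nonempty := by
    obtain ⟨F, hF, -⟩ := mem_traces.1 hP
    exact nonempty_iff_ne_empty.2 fun h0 => h.not_disjoint_trace hP hF (h0 ▸ disjoint_empty_left F)
  obtain ⟨j, rfl⟩ := card_eq_one.1 (show #P = 1 by have := hne.card_pos; lia)
  have hj1 : 1 ≤ j := by
    obtain ⟨F, -, hFP⟩ := mem_traces.1 hP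
    exact (mem_Icc.1 (mem_inter.1 (hFP ▸ mem_singleton_self j)).2).1
  have h1 : {1} ∈ traces (2 * r) 𝒜 := by
    obtain rfl | hlt := hj1.eq_or_lt
    · exact hP
    · simpa using h.insert_erase_mem_traces hP (mem_singleton_self j)
        (by simpa using hlt.ne) le_rfl hlt
  refine hS fun G hG => mem_star.2 ⟨h.subset_layer hG, ?_⟩
  simpa using h.not_disjoint_trace h1 hG

lemma IsLCIF.subset_AHM_three (h : IsLCIF n r 𝒜) (h23 : {2, 3} ∈ traces (2 * r) 𝒜) :
    𝒜 ⊆ AHM n r 3 := by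
  have hpair {i j : ℕ} (hij : {i, j} ∈ traces (2 * r) 𝒜) {G : Finset ℕ} (hG : G ∈ 𝒜) :
      i ∈ G ∨ j ∈ G := by
    by_contra! hc
    exact h.not_disjoint_trace hij hG (by simp [hc])
  have h12 : {1, 2} ∈ traces (2 * r) 𝒜 :=
    h.pair_mem_traces_of_le (by lia) h23 le_rfl (by lia) (by lia) (by lia)
  have h13 : {1, 3} ∈ traces (2 * r) 𝒜 :=
    h.pair_mem_traces_of_le (by lia) h23 le_rfl (by lia) (by lia) le_rfl
  intro G hG
  have := hpair h12 hG
  have := hpair h13 hG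
  have := hpair h23 hG
  exact mem_AHM_three.2 ⟨h.subset_layer hG, by tauto⟩

lemma IsLCIF.Icc_subset_of_one_notMem (h : IsLCIF n r 𝒜) {m : ℕ}
    (hm : {1, m} ∈ traces (2 * r) 𝒜) (hF : F ∈ 𝒜) (h1 : 1 ∉ F) : Icc 2 m ⊆ F := by
  intro j hj
  rw [mem_Icc] at hj
  have hj' : {1, j} ∈ traces (2 * r) 𝒜 :=
    h.pair_mem_traces_of_le (by lia) hm le_rfl le_rfl (by lia) hj.2
  simpa [h1] using h.not_disjoint_trace hj' hF

end Shifting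

section Maximal

lemma isLCIF_star : IsLCIF n r (star n r) where
  subset_layer := filter_subset _ _
  leftCompressed := by
    refine (isLeftCompressed_iff fun _ hF => (mem_star.1 hF).1).2 fun F hF i hi j hj hj1 hji => ?_
    rw [mem_star] at hF ⊢
    have hin := mem_Icc.1 ((mem_layer.1 hF.1).1 hi)
    refine ⟨insert_erase_mem_layer hF.1 (mem_Icc.2 ⟨hj1, by lia⟩) hi hj, ?_⟩
    exact mem_insert_of_mem (mem_erase.2 ⟨by lia, hF.2⟩)
  intersecting _ hF _ hG := not_disjoint_iff.2 ⟨1, (mem_star.1 hF).2, (mem_star.1 hG).2⟩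

lemma isLCIF_AHM (ht : 3 ≤ t) : IsLCIF n r (AHM n r t) where
  subset_layer _ hF := (mem_AHM.1 hF).1
  leftCompressed := by
    refine (isLeftCompressed_iff fun _ hF => (mem_AHM.1 hF).1).2 fun F hF i hi j hj hj1 hji => ?_
    rw [mem_AHM] at hF ⊢
    have hin := mem_Icc.1 ((mem_layer.1 hF.1).1 hi)
    refine ⟨insert_erase_mem_layer hF.1 (mem_Icc.2 ⟨hj1, by lia⟩) hi hj, ?_⟩
    obtain ⟨h1, x, hx, hxt⟩ | hsub := hF.2
    · rw [mem_Icc] at hxt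
      refine Or.inl ⟨by grind, ?_⟩
      obtain rfl | hxi := eq_or_ne x i
      · exact ⟨j, mem_insert_self _ _, by grind⟩
      · exact ⟨x, by grind, mem_Icc.2 hxt⟩
    · have h2 : 2 ∈ F := hsub (mem_Icc.2 (by lia))
      have h3 : 3 ∈ F := hsub (mem_Icc.2 (by lia))
      obtain rfl | hj1' := hj1.eq_or_lt
      · refine Or.inl ⟨mem_insert_self _ _, ?_⟩
        obtain rfl | hi2 := eq_or_ne i 2
        · exact ⟨3, by grind, mem_Icc.2 (by lia)⟩
        · exact ⟨2, by grind, mem_Icc.2 (by lia)⟩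
      · exact Or.inr fun y hy => by grind
  intersecting F hF G hG := by
    rw [mem_coe, mem_AHM] at hF hG
    rw [not_disjoint_iff]
    obtain ⟨h1, x, hx, hxt⟩ | hsub := hF.2 <;> obtain ⟨h1', y, hy, hyt⟩ | hsub' := hG.2
    · exact ⟨1, h1, h1'⟩
    · exact ⟨x, hx, hsub' hxt⟩
    · exact ⟨y, hsub hyt, hy⟩
    · exact ⟨2, hsub (mem_Icc.2 (by lia)), hsub' (mem_Icc.2 (by lia))⟩

lemma isMLCIF_star (hr : 1 ≤ r) (hn : r + r ≤ n) : IsMLCIF n r (star n r) := by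
  refine ⟨isLCIF_star, fun ℬ hℬ hsub F hF => mem_star.2 ⟨hℬ.subset_layer hF, ?_⟩⟩
  by_contra h1
  obtain ⟨W, hW, hW1, hWF⟩ := exists_mem_layer_superset_disjoint (n := n) (P := {1}) (Q := F)
    (by simp; lia) (by simpa) (by simpa) (by rwa [(mem_layer.1 (hℬ.subset_layer hF)).2])
  exact hℬ.intersecting (hsub (mem_star.2 ⟨hW, singleton_subset_iff.1 hW1⟩)) hF hWF

lemma isMLCIF_AHM (ht : 3 ≤ t) (htr : t ≤ r + 1) (hn : r + r < n) :
    IsMLCIF n r (AHM n r t) := by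
  refine ⟨isLCIF_AHM ht, fun ℬ hℬ hsub F hF => mem_AHM.2 ⟨hℬ.subset_layer hF, ?_⟩⟩
  have hFr := (mem_layer.1 (hℬ.subset_layer hF)).2
  by_cases h1 : 1 ∈ F
  · refine Or.inl ⟨h1, ?_⟩
    by_contra! hc
    obtain ⟨W, hW, hWt, hWF⟩ := exists_mem_layer_superset_disjoint (n := n) (r := r)
      (P := Icc 2 t) (Q := F) (Icc_subset_Icc one_le_two (by lia)) (by simp; lia)
      (disjoint_right.2 hc) (by lia)
    exact hℬ.intersecting (hsub (mem_AHM.2 ⟨hW, Or.inr hWt⟩)) hF hWF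
  · refine Or.inr fun j hj => ?_
    by_contra hjF
    have hj' := mem_Icc.1 hj
    obtain ⟨W, hW, hWj, hWF⟩ := exists_mem_layer_superset_disjoint (n := n) (r := r)
      (P := {1, j}) (Q := F) (by grind) (card_le_two.trans (by lia)) (by simp [h1, hjF]) (by lia)
    rw [insert_subset_iff, singleton_subset_iff] at hWj
    exact hℬ.intersecting (hsub (mem_AHM.2 ⟨hW, Or.inl ⟨hWj.1, j, hWj.2, hj⟩⟩)) hF hWF

lemma IsLCIF.exists_isMLCIF_superset (h : IsLCIF n r 𝒜) : ∃ ℬ, IsMLCIF n r ℬ ∧ 𝒜 ⊆ ℬ := by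
  have hfin : {ℬ | IsLCIF n r ℬ}.Finite :=
    (layer n r).powerset.finite_toSet.subset fun ℬ hℬ => mem_coe.2 (mem_powerset.2 hℬ.subset_layer)
  obtain ⟨ℬ, hsub, hℬ⟩ := hfin.exists_le_maximal h
  exact ⟨ℬ, hℬ, hsub⟩

lemma AHM_subset_star (ht : r + 1 < t) : AHM n r t ⊆ star n r := by
  intro F hF
  obtain ⟨hFl, ⟨h1, -⟩ | hsub⟩ := mem_AHM.1 hF
  · exact mem_star.2 ⟨hFl, h1⟩
  · have := card_le_card hsub
    rw [Nat.card_Icc, (mem_layer.1 hFl).2] at this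
    lia

lemma IsLCIF.AHM_subset_of_forall_mem (h : IsLCIF n r 𝒜) (ht : t ∈ Icc 2 n)
    (hA : ∀ F ∈ AHM n r t, t ∈ F → F ∈ 𝒜) : AHM n r t ⊆ 𝒜 := by
  intro F hF
  rw [mem_Icc] at ht
  by_cases htF : t ∈ F
  · exact hA F hF htF
  obtain ⟨hFl, ⟨h1, x, hx, hxt⟩ | hsub⟩ := mem_AHM.1 hF
  · rw [mem_Icc] at hxt
    have hxt' : x < t := hxt.2.lt_of_ne (ne_of_mem_of_not_mem hx htF)
    refine h.mem_of_insert_erase_mem htF hx (by lia) hxt' (hA _ ?_ (mem_insert_self _ _))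
    exact mem_AHM.2 ⟨insert_erase_mem_layer hFl (mem_Icc.2 (by lia)) hx htF,
      Or.inl ⟨by grind, t, mem_insert_self _ _, mem_Icc.2 (by lia)⟩⟩
  · exact absurd (hsub (mem_Icc.2 ⟨ht.1, le_rfl⟩)) htF

lemma IsLCIF.AHM_three_subset_of_forall_mem (h : IsLCIF n r 𝒜) (hn : 3 ≤ n) {i : ℕ}
    (hi : i ∈ ({2, 3} : Finset ℕ)) (hA : ∀ F ∈ AHM n r 3, i ∈ F → F ∈ 𝒜) : AHM n r 3 ⊆ 𝒜 := by
  intro F hF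
  by_cases hiF : i ∈ F
  · exact hA F hF hiF
  obtain ⟨hFl, hF3⟩ := mem_AHM_three.1 hF
  have h1 : 1 ∈ F := by grind
  refine h.mem_of_insert_erase_mem hiF h1 le_rfl (by grind) (hA _ ?_ (mem_insert_self _ _))
  exact mem_AHM_three.2 ⟨insert_erase_mem_layer hFl (by grind) h1 hiF, by grind⟩

end Maximal

section Hitting

lemma hit_mono (h : 𝒜 ⊆ ℬ) : hit X 𝒜 ≤ hit X ℬ := card_le_card (filter_subset_filter _ h)

lemma mem_of_hit_le (h : ∀ F ∈ 𝒜, (F ∩ X).Nonempty → F ∈ ℬ) (hle : hit X ℬ ≤ hit X 𝒜)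
    (hF : F ∈ ℬ) (hFX : (F ∩ X).Nonempty) : F ∈ 𝒜 := by
  have hsub : {A ∈ 𝒜 | (A ∩ X).Nonempty} ⊆ {A ∈ ℬ | (A ∩ X).Nonempty} := fun G hG =>
    mem_filter.2 ⟨h G (mem_filter.1 hG).1 (mem_filter.1 hG).2, (mem_filter.1 hG).2⟩
  have hFℬ : F ∈ {A ∈ ℬ | (A ∩ X).Nonempty} := mem_filter.2 ⟨hF, hFX⟩
  rw [← eq_of_subset_of_card_le hsub hle] at hFℬ
  exact (mem_filter.1 hFℬ).1

lemma IsOptimalMLCIF.isOptimalLCIF (h : IsOptimalMLCIF n r X 𝒜) : IsOptimalLCIF n r X 𝒜 := by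
  refine ⟨h.1.prop, fun ℱ hℱ => ?_⟩
  obtain ⟨ℬ, hℬ, hsub⟩ := hℱ.exists_isMLCIF_superset
  exact (hit_mono hsub).trans (h.2 ℬ hℬ)

lemma mem_AHM_of_mem_star (hX : X ⊆ Icc 2 t) (hF : F ∈ star n r) (hFX : (F ∩ X).Nonempty) :
    F ∈ AHM n r t := by
  obtain ⟨x, hx⟩ := hFX
  rw [mem_inter] at hx
  exact mem_AHM.2 ⟨(mem_star.1 hF).1, Or.inl ⟨(mem_star.1 hF).2, x, hx.1, hX hx.2⟩⟩

lemma hit_star_le_hit_of_AHM_subset (hX : X ⊆ Icc 2 t) (h : AHM n r t ⊆ 𝒜) :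
    hit X (star n r) ≤ hit X 𝒜 :=
  card_le_card fun _ hF => mem_filter.2
    ⟨h (mem_AHM_of_mem_star hX (mem_filter.1 hF).1 (mem_filter.1 hF).2), (mem_filter.1 hF).2⟩

lemma hit_star_lt_hit_AHM (htr : t ≤ r + 1) (hn : r < n) (hX : X ⊆ Icc 2 t)
    (hne : X.Nonempty) : hit X (star n r) < hit X (AHM n r t) := by
  refine (hit_star_le_hit_of_AHM_subset hX Subset.rfl).lt_of_ne fun heq => ?_
  obtain ⟨x, hx⟩ := hne
  obtain ⟨W, hW, hsub, hW1⟩ := exists_mem_layer_superset_disjoint (n := n) (r := r)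
    (P := Icc 2 t) (Q := {1}) (Icc_subset_Icc one_le_two (by lia)) (by simp; lia) (by simp)
    (by simp; lia)
  have hWS : W ∈ star n r := mem_of_hit_le (fun F => mem_AHM_of_mem_star hX) heq.ge
    (mem_AHM.2 ⟨hW, Or.inr hsub⟩) ⟨x, mem_inter.2 ⟨hsub (hX hx), hx⟩⟩
  exact disjoint_singleton_right.1 hW1 (mem_star.1 hWS).2

lemma card_filter_layer_subset_disjoint {P Q : Finset ℕ} (hP : P ⊆ Icc 1 n) (hQ : Q ⊆ Icc 1 n)
    (hPQ : Disjoint P Q) (hPr : #P ≤ r) :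
    #{F ∈ layer n r | P ⊆ F ∧ Disjoint F Q} = (n - #Q - #P).choose (r - #P) := by
  have hset : {F ∈ layer n r | P ⊆ F ∧ Disjoint F Q} =
      {F ∈ (Icc 1 n \ Q).powersetCard r | P ⊆ F} := by
    ext F
    simp only [mem_filter, mem_layer, mem_powersetCard, subset_sdiff]
    tauto
  rw [hset, card_filter_powersetCard_subset _ _ _ (subset_sdiff.2 ⟨hP, hPQ⟩) hPr,
    card_sdiff_of_subset hQ, Nat.card_Icc, Nat.add_sub_cancel]

lemma hit_lt_hit_of_hit_sdiff_lt (h : hit X (𝒜 \ ℬ) < hit X (ℬ \ 𝒜)) : hit X 𝒜 < hit X ℬ := by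
  have hsdiff (𝒞 𝒟 : Finset (Finset ℕ)) : {A ∈ 𝒞 \ 𝒟 | (A ∩ X).Nonempty} =
      {A ∈ 𝒞 | (A ∩ X).Nonempty} \ {A ∈ 𝒟 | (A ∩ X).Nonempty} := by grind
  simp only [hit, hsdiff] at h ⊢
  exact card_sdiff_lt_card_sdiff_iff.1 h

lemma hit_star_sdiff_AHM_three_le (hr : 2 ≤ r) (hX : X ⊆ Icc 2 n) :
    hit X (star n r \ AHM n r 3) ≤ #(X \ {2, 3}) * (n - 4).choose (r - 2) := by
  have hcover : {F ∈ star n r \ AHM n r 3 | (F ∩ X).Nonempty} ⊆ (X \ {2, 3}).biUnion fun x =>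
      {F ∈ layer n r | {1, x} ⊆ F ∧ Disjoint F {2, 3}} := by
    intro F hF
    simp only [mem_sdiff, mem_filter, mem_star, mem_AHM_three, Finset.Nonempty, mem_inter] at hF
    obtain ⟨⟨⟨hFl, h1⟩, hF3⟩, x, hxF, hxX⟩ := hF
    have h2 : 2 ∉ F := by grind
    have h3 : 3 ∉ F := by grind
    exact mem_biUnion.2 ⟨x, by grind, by simp [hFl, h1, hxF, h2, h3, insert_subset_iff]⟩
  refine (card_le_card hcover).trans (card_biUnion_le_card_mul _ _ _ fun x hx => ?_)
  simp only [mem_sdiff, mem_insert, mem_singleton, not_or] at hx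
  have hx' := mem_Icc.1 (hX hx.1)
  have hpair : #{1, x} = 2 := card_pair (by lia)
  rw [card_filter_layer_subset_disjoint (by grind) (by grind) (by simp; lia) (hpair.trans_le hr),
    hpair, card_pair (by decide), Nat.sub_sub]

lemma choose_le_hit_AHM_three_sdiff_star (hr : 2 ≤ r) (hn : 3 ≤ n) (h23 : (X ∩ {2, 3}).Nonempty) :
    (n - 3).choose (r - 2) ≤ hit X (AHM n r 3 \ star n r) := by
  have hcard : #{F ∈ layer n r | {2, 3} ⊆ F ∧ Disjoint F {1}} = (n - 3).choose (r - 2) := by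
    rw [card_filter_layer_subset_disjoint (by grind) (by grind) (by simp) (by simpa),
      card_pair (by decide), card_singleton, Nat.sub_sub]
  rw [← hcard]
  refine card_le_card fun F hF => ?_
  obtain ⟨x, hx⟩ := h23
  simp only [mem_filter, insert_subset_iff, singleton_subset_iff, disjoint_singleton_right] at hF
  obtain ⟨hFl, ⟨h2, h3⟩, h1⟩ := hF
  refine mem_filter.2 ⟨mem_sdiff.2 ⟨mem_AHM_three.2 ⟨hFl, by tauto⟩, ?_⟩, x, by grind⟩
  exact fun hFS => h1 (mem_star.1 hFS).2

lemma hit_star_lt_hit_AHM_three (hr : 3 ≤ r) (hn : r < n) (hX : X ⊆ Icc 2 n)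
    (h23 : (X ∩ {2, 3}).Nonempty) (hcard : #(X \ {2, 3}) ≤ 1) :
    hit X (star n r) < hit X (AHM n r 3) := by
  refine hit_lt_hit_of_hit_sdiff_lt ?_
  have hpascal : (n - 3).choose (r - 2) = (n - 4).choose (r - 3) + (n - 4).choose (r - 2) := by
    obtain ⟨r, rfl⟩ := Nat.exists_eq_add_of_le' hr
    obtain ⟨n, rfl⟩ := Nat.exists_eq_add_of_le' (show 4 ≤ n by lia)
    exact Nat.choose_succ_succ n r
  have hpos : 0 < (n - 4).choose (r - 3) := Nat.choose_pos (by lia)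
  calc hit X (star n r \ AHM n r 3)
    _ ≤ #(X \ {2, 3}) * (n - 4).choose (r - 2) := hit_star_sdiff_AHM_three_le (by lia) hX
    _ ≤ 1 * (n - 4).choose (r - 2) := Nat.mul_le_mul_right _ hcard
    _ < (n - 3).choose (r - 2) := by lia
    _ ≤ hit X (AHM n r 3 \ star n r) :=
      choose_le_hit_AHM_three_sdiff_star (by lia) (by lia) h23

end Hitting

section Counting

variable {𝒢 𝒬 𝒯 : Finset (Finset ℕ)} {P : Finset ℕ}

/-- The family of `r`-element subsets of `[n]` generated by `𝒢`, that is, those that contain a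
member of `𝒢`. -/
def generated (n r : ℕ) (𝒢 : Finset (Finset ℕ)) : Finset (Finset ℕ) :=
  {F ∈ layer n r | ∃ P ∈ 𝒢, P ⊆ F}

lemma mem_generated : F ∈ generated n r 𝒢 ↔ F ∈ layer n r ∧ ∃ P ∈ 𝒢, P ⊆ F := mem_filter

lemma card_filter_layer_subset (hP : P ⊆ Icc 1 n) (hPr : #P ≤ r) :
    #{F ∈ layer n r | P ⊆ F} = (n - #P).choose (r - #P) := by
  simpa using card_filter_layer_subset_disjoint hP (empty_subset _) (disjoint_empty_right P) hPr

lemma card_filter_layer_subset_le (ht : t ≤ #P) :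
    #{F ∈ layer n r | P ⊆ F} ≤ (n - t).choose (r - t) := by
  obtain ⟨T, hTP, rfl⟩ := exists_subset_card_eq ht
  by_cases hT : T ⊆ Icc 1 n ∧ #T ≤ r
  · rw [← card_filter_layer_subset hT.1 hT.2]
    exact card_le_card (monotone_filter_right _ fun F _ => hTP.trans)
  · rw [filter_false_of_mem]
    · exact Nat.zero_le _
    · intro F hF hPF
      rw [mem_layer] at hF
      have hTF := hTP.trans hPF
      exact hT ⟨hTF.trans hF.1, (card_le_card hTF).trans hF.2.le⟩

lemma card_generated_le (h𝒢 : ∀ P ∈ 𝒢, t ≤ #P) :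
    #(generated n r 𝒢) ≤ #𝒢 * (n - t).choose (r - t) := by
  have hcover : generated n r 𝒢 ⊆ 𝒢.biUnion fun P => {F ∈ layer n r | P ⊆ F} := by
    intro F hF
    obtain ⟨hFl, P, hP, hPF⟩ := mem_generated.1 hF
    exact mem_biUnion.2 ⟨P, hP, mem_filter.2 ⟨hFl, hPF⟩⟩
  exact (card_le_card hcover).trans
    (card_biUnion_le_card_mul _ _ _ fun P hP => card_filter_layer_subset_le (h𝒢 P hP))

lemma choose_add_card_generated_le (hP : P ∈ powersetCard t (Icc 1 n)) (ht : t ≤ r)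
    (hℬ : ℬ ⊆ powersetCard t (Icc 1 n)) (hPℬ : P ∉ ℬ) :
    (n - t).choose (r - t) + #(generated n r ℬ) ≤
      #(generated n r (insert P ℬ)) + #ℬ * (n - (t + 1)).choose (r - (t + 1)) := by
  obtain ⟨hPn, rfl⟩ := mem_powersetCard.1 hP
  have hunion : {F ∈ layer n r | P ⊆ F} ∪ generated n r ℬ = generated n r (insert P ℬ) := by
    ext F
    simp only [mem_union, mem_filter, mem_generated, mem_insert, exists_eq_or_imp, and_or_left]
  have hinter : {F ∈ layer n r | P ⊆ F} ∩ generated n r ℬ ⊆ generated n r (ℬ.image (P ∪ ·)) := by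
    intro F hF
    simp only [mem_inter, mem_filter, mem_generated] at hF
    obtain ⟨⟨hFl, hPF⟩, -, Q, hQ, hQF⟩ := hF
    exact mem_generated.2 ⟨hFl, _, mem_image_of_mem _ hQ, union_subset hPF hQF⟩
  have hlarge : ∀ T ∈ ℬ.image (P ∪ ·), #P + 1 ≤ #T := by
    refine forall_mem_image.2 fun Q hQ => card_lt_card ?_
    refine subset_union_left.ssubset_of_ne fun heq => hPℬ ?_
    rwa [← eq_of_subset_of_card_le (union_eq_left.1 heq.symm)
      (mem_powersetCard.1 (hℬ hQ)).2.ge]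
  calc (n - #P).choose (r - #P) + #(generated n r ℬ)
    _ = #(generated n r (insert P ℬ)) + #({F ∈ layer n r | P ⊆ F} ∩ generated n r ℬ) := by
      rw [← card_filter_layer_subset hPn ht, ← card_union_add_card_inter, hunion]
    _ ≤ #(generated n r (insert P ℬ)) + #(generated n r (ℬ.image (P ∪ ·))) := by gcongr
    _ ≤ _ := by grw [card_generated_le hlarge, card_image_le]

lemma mul_choose_le_card_generated_add (ht : t ≤ r) (hℬ : ℬ ⊆ powersetCard t (Icc 1 n)) :
    #ℬ * (n - t).choose (r - t) ≤
      #(generated n r ℬ) + #ℬ ^ 2 * (n - (t + 1)).choose (r - (t + 1)) := by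
  induction ℬ using Finset.induction_on with
  | empty => simp
  | insert P ℬ hP ih =>
    rw [insert_subset_iff] at hℬ
    have hstep := choose_add_card_generated_le hℬ.1 ht hℬ.2 hP
    have := ih hℬ.2
    rw [card_insert_of_notMem hP]
    nlinarith

-- The leading terms of both counts are multiples of `(n - t).choose (r - t)`, by the numbers of
-- `t`-element generators.
lemma card_lt_card_of_generated {ℱ : Finset (Finset ℕ)} (ht : t ≤ r)
    (hcover : ℱ ⊆ generated n r 𝒬 ∪ generated n r 𝒯) (h𝒬 : ∀ Q ∈ 𝒬, t ≤ #Q)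
    (h𝒯 : ∀ T ∈ 𝒯, t + 1 ≤ #T) (hℬ : ℬ ⊆ powersetCard t (Icc 1 n))
    (hsub : generated n r ℬ ⊆ 𝒢) (hlt : #𝒬 < #ℬ)
    (herr : (#𝒯 + #ℬ ^ 2) * (n - (t + 1)).choose (r - (t + 1)) < (n - t).choose (r - t)) :
    #ℱ < #𝒢 := by
  set a := (n - t).choose (r - t)
  set b := (n - (t + 1)).choose (r - (t + 1))
  have hupper : #ℱ ≤ #𝒬 * a + #𝒯 * b :=
    (card_le_card hcover).trans ((card_union_le _ _).trans
      (add_le_add (card_generated_le h𝒬) (card_generated_le h𝒯)))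
  have hlower : #ℬ * a ≤ #𝒢 + #ℬ ^ 2 * b :=
    (mul_choose_le_card_generated_add ht hℬ).trans (by gcongr)
  have hlead : (#𝒬 + 1) * a ≤ #ℬ * a := Nat.mul_le_mul_right a hlt
  linarith

lemma mul_choose_lt_choose_succ {d m k : ℕ} (hkm : k ≤ m) (hd : d * (k + 1) < m + 1) :
    d * m.choose k < (m + 1).choose (k + 1) := by
  refine Nat.lt_of_mul_lt_mul_right (a := k + 1) ?_
  calc d * m.choose k * (k + 1)
    _ = d * (k + 1) * m.choose k := by ring
    _ < (m + 1) * m.choose k := Nat.mul_lt_mul_of_pos_right hd (Nat.choose_pos hkm)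
    _ = (m + 1).choose (k + 1) * (k + 1) := Nat.add_one_mul_choose_eq m k

/-- A size of `X` from which on, for large `n`, the star beats every left-compressed intersecting
family that is not contained in it, since such families are generated by pairs in `[2r]`. -/
def pairBound (r : ℕ) : ℕ := (2 * r).choose 2 + 1

/-- A value of `n` from which on, in the comparisons below, the sets that contain a given pair
outnumber all those that contain a triple arising as an error term. -/
def threshold (r : ℕ) : ℕ :=
  ((2 * r + pairBound r).choose 3 + pairBound r ^ 2) * r + 2 * r + 4

lemma two_mul_add_four_le_of_threshold_le (hn : threshold r ≤ n) : 2 * r + 4 ≤ n := by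
  rw [threshold] at hn
  lia

lemma mul_choose_lt_choose_of_threshold_le {c p : ℕ} (hr : 3 ≤ r) (hn : threshold r ≤ n)
    (hc : c ≤ (2 * r + pairBound r).choose 3) (hp : p ≤ pairBound r) :
    (c + p ^ 2) * (n - 3).choose (r - 3) < (n - 2).choose (r - 2) := by
  have hn' := two_mul_add_four_le_of_threshold_le hn
  have hle : (c + p ^ 2) * (r - 2) ≤
      ((2 * r + pairBound r).choose 3 + pairBound r ^ 2) * r := by
    gcongr
    exact Nat.sub_le r 2
  rw [threshold] at hn
  convert mul_choose_lt_choose_succ (d := c + p ^ 2) (m := n - 3) (k := r - 3) (by lia) ?_ using 2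
  · lia
  · lia
  · rw [show r - 3 + 1 = r - 2 by lia]
    lia

end Counting

section PairTraces

/-- The two-element traces on `[k]` of the members of `𝒜`. -/
def pairTraces (k : ℕ) (𝒜 : Finset (Finset ℕ)) : Finset (Finset ℕ) := {P ∈ traces k 𝒜 | #P = 2}

variable {P : Finset ℕ}

lemma mem_pairTraces : P ∈ pairTraces k 𝒜 ↔ P ∈ traces k 𝒜 ∧ #P = 2 := mem_filter

lemma IsLCIF.filter_subset_generated_union (h : IsLCIF n r 𝒜) (hS : ¬ 𝒜 ⊆ star n r) :
    {F ∈ 𝒜 | (F ∩ X).Nonempty} ⊆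
      generated n r {P ∈ pairTraces (2 * r) 𝒜 | (P ∩ X).Nonempty} ∪
        generated n r (powersetCard 3 (Icc 1 (2 * r) ∪ X)) := by
  intro F hF
  obtain ⟨hF, x, hx⟩ := mem_filter.1 hF
  have hFl := h.subset_layer hF
  rw [mem_inter] at hx
  set P := F ∩ Icc 1 (2 * r)
  have hPtr : P ∈ traces (2 * r) 𝒜 := mem_traces.2 ⟨F, hF, rfl⟩
  have hP2 := h.two_le_card_of_mem_traces hS hPtr
  by_cases hpair : #P = 2 ∧ (P ∩ X).Nonempty
  · exact mem_union_left _ (mem_generated.2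
      ⟨hFl, P, mem_filter.2 ⟨mem_pairTraces.2 ⟨hPtr, hpair.1⟩, hpair.2⟩, inter_subset_left⟩)
  · have h3 : 3 ≤ #(insert x P) := by
      by_cases hxP : x ∈ P
      · have hne : #P ≠ 2 := fun hc => hpair ⟨hc, x, mem_inter.2 ⟨hxP, hx.2⟩⟩
        rw [insert_eq_of_mem hxP]
        lia
      · rw [card_insert_of_notMem hxP]
        lia
    obtain ⟨T, hT, hT3⟩ := exists_subset_card_eq h3
    refine mem_union_right _ (mem_generated.2 ⟨hFl, T, mem_powersetCard.2 ⟨?_, hT3⟩, ?_⟩)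
    · exact hT.trans (insert_subset (mem_union_right _ hx.2)
        (inter_subset_right.trans subset_union_left))
    · exact hT.trans (insert_subset hx.1 inter_subset_left)

lemma IsLCIF.subset_generated_powersetCard_two (h : IsLCIF n r 𝒜) (hS : ¬ 𝒜 ⊆ star n r) :
    𝒜 ⊆ generated n r (powersetCard 2 (Icc 1 (2 * r))) := by
  intro F hF
  obtain ⟨T, hT, hT2⟩ := exists_subset_card_eq
    (h.two_le_card_of_mem_traces hS (mem_traces.2 ⟨F, hF, rfl⟩))
  exact mem_generated.2 ⟨h.subset_layer hF, T,
    mem_powersetCard.2 ⟨hT.trans inter_subset_right, hT2⟩, hT.trans inter_subset_left⟩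

lemma card_powersetCard_three_le (hX : #X ≤ pairBound r) :
    #(powersetCard 3 (Icc 1 (2 * r) ∪ X)) ≤ (2 * r + pairBound r).choose 3 := by
  rw [card_powersetCard]
  refine Nat.choose_le_choose 3 ((card_union_le _ _).trans ?_)
  simpa using hX

lemma hit_lt_hit_star_of_cover {𝒬 𝒯 : Finset (Finset ℕ)} {Y : Finset ℕ} (hr : 3 ≤ r)
    (hn : threshold r ≤ n) (hX : X ⊆ Icc 2 n) (hY : Y ⊆ X) (hYc : #Y ≤ pairBound r)
    (hcover : {F ∈ 𝒜 | (F ∩ X).Nonempty} ⊆ generated n r 𝒬 ∪ generated n r 𝒯)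
    (h𝒬 : ∀ Q ∈ 𝒬, 2 ≤ #Q) (h𝒯 : ∀ T ∈ 𝒯, 3 ≤ #T)
    (h𝒯c : #𝒯 ≤ (2 * r + pairBound r).choose 3) (hlt : #𝒬 < #Y) :
    hit X 𝒜 < hit X (star n r) := by
  have hY2 {x : ℕ} (hx : x ∈ Y) := mem_Icc.1 (hX (hY hx))
  have hcard : #(Y.image fun x => ({1, x} : Finset ℕ)) = #Y := by
    refine card_image_of_injOn fun x hx y _ hxy => ?_
    have hxy' : x ∈ ({1, y} : Finset ℕ) := hxy ▸ mem_insert_of_mem (mem_singleton_self x)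
    have := hY2 hx
    rw [mem_insert, mem_singleton] at hxy'
    lia
  refine card_lt_card_of_generated (ℬ := Y.image fun x => {1, x}) (t := 2) (by lia) hcover h𝒬 h𝒯
    ?_ ?_ (hcard ▸ hlt) (mul_choose_lt_choose_of_threshold_le hr hn h𝒯c (hcard ▸ hYc))
  · refine image_subset_iff.2 fun x hx => mem_powersetCard.2 ⟨?_, ?_⟩
    · have := hY2 hx
      grind
    · exact card_pair (by have := hY2 hx; lia)
  · intro F hF
    obtain ⟨hFl, P, hP, hPF⟩ := mem_generated.1 hF
    obtain ⟨x, hx, rfl⟩ := mem_image.1 hP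
    rw [insert_subset_iff, singleton_subset_iff] at hPF
    exact mem_filter.2 ⟨mem_star.2 ⟨hFl, hPF.1⟩, x, mem_inter.2 ⟨hPF.2, hY hx⟩⟩

lemma IsLCIF.hit_lt_hit_star (h : IsLCIF n r 𝒜) (hr : 3 ≤ r) (hn : threshold r ≤ n)
    (hX : X ⊆ Icc 2 n) (hS : ¬ 𝒜 ⊆ star n r) (hlt : hit X (pairTraces (2 * r) 𝒜) < #X) :
    hit X 𝒜 < hit X (star n r) := by
  obtain hXc | hXc := le_total #X (pairBound r)
  · refine hit_lt_hit_star_of_cover hr hn hX Subset.rfl hXc (h.filter_subset_generated_union hS)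
      (fun Q hQ => (mem_pairTraces.1 (mem_filter.1 hQ).1).2.ge)
      (fun T hT => (mem_powersetCard.1 hT).2.ge) (card_powersetCard_three_le hXc) hlt
  · obtain ⟨Y, hYX, hYc⟩ := exists_subset_card_eq hXc
    refine hit_lt_hit_star_of_cover (𝒬 := powersetCard 2 (Icc 1 (2 * r))) (𝒯 := ∅) hr hn hX hYX
      hYc.le ?_ (fun Q hQ => (mem_powersetCard.1 hQ).2.ge) (by simp) (by simp) ?_
    · exact (filter_subset _ _).trans
        ((h.subset_generated_powersetCard_two hS).trans subset_union_left)
    · rw [hYc, card_powersetCard, Nat.card_Icc, pairBound]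
      exact Nat.lt_succ_self _

lemma IsLCIF.one_mem_of_mem_pairTraces (h : IsLCIF n r 𝒜) (h23 : {2, 3} ∉ traces k 𝒜)
    (hP : P ∈ pairTraces k 𝒜) : 1 ∈ P := by
  by_contra h1
  obtain ⟨hPtr, hP2⟩ := mem_pairTraces.1 hP
  have hpos : ∀ x ∈ P, 1 ≤ x := by
    obtain ⟨F, -, rfl⟩ := mem_traces.1 hPtr
    exact fun x hx => (mem_Icc.1 (mem_inter.1 hx).2).1
  obtain ⟨i, j, hij, rfl⟩ : ∃ i j, i < j ∧ P = {i, j} := by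
    obtain ⟨i, j, hne, rfl⟩ := card_eq_two.1 hP2
    obtain hlt | hlt := hne.lt_or_gt
    exacts [⟨i, j, hlt, rfl⟩, ⟨j, i, hlt, pair_comm i j⟩]
  have hi : 2 ≤ i := by
    have := hpos i (mem_insert_self _ _)
    grind
  exact h23 (h.pair_mem_traces_of_le hij hPtr one_le_two hi (by lia) (by lia))

lemma IsLCIF.filter_pairTraces_subset_image (h : IsLCIF n r 𝒜) (h23 : {2, 3} ∉ traces k 𝒜)
    (h1X : 1 ∉ X) :
    {P ∈ pairTraces k 𝒜 | (P ∩ X).Nonempty} ⊆ X.image fun x => {1, x} := by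
  intro P hP
  obtain ⟨hP, x, hx⟩ := mem_filter.1 hP
  rw [mem_inter] at hx
  refine mem_image.2 ⟨x, hx.2, eq_of_subset_of_card_le ?_ ?_⟩
  · exact insert_subset (h.one_mem_of_mem_pairTraces h23 hP) (singleton_subset_iff.2 hx.1)
  · rw [(mem_pairTraces.1 hP).2, card_pair (ne_of_mem_of_not_mem hx.2 h1X).symm]

lemma IsLCIF.pair_one_mem_traces (h : IsLCIF n r 𝒜) (h23 : {2, 3} ∉ traces k 𝒜) (h1X : 1 ∉ X)
    (hle : #X ≤ hit X (pairTraces k 𝒜)) {x : ℕ} (hx : x ∈ X) : {1, x} ∈ traces k 𝒜 := by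
  have heq := eq_of_subset_of_card_le (h.filter_pairTraces_subset_image h23 h1X)
    (card_image_le.trans hle)
  have hmem := mem_image_of_mem (fun x => ({1, x} : Finset ℕ)) hx
  rw [← heq, mem_filter, mem_pairTraces] at hmem
  exact hmem.1.1

lemma IsLCIF.hit_singleton_two_lt_hit_AHM_three (h : IsLCIF n r 𝒜) (hr : 3 ≤ r)
    (hn : threshold r ≤ n) (hS : ¬ 𝒜 ⊆ star n r) (h23 : {2, 3} ∉ traces (2 * r) 𝒜) :
    hit {2} 𝒜 < hit {2} (AHM n r 3) := by
  have hn' := two_mul_add_four_le_of_threshold_le hn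
  have hbound : 2 ≤ pairBound r := by
    have : 0 < (2 * r).choose 2 := Nat.choose_pos (by lia)
    rw [pairBound]
    lia
  have hone : hit {2} (pairTraces (2 * r) 𝒜) ≤ 1 :=
    card_le_card (h.filter_pairTraces_subset_image h23 (by decide))
  have hcard : #({{1, 2}, {2, 3}} : Finset (Finset ℕ)) = 2 := by decide
  refine card_lt_card_of_generated (ℬ := {{1, 2}, {2, 3}}) (t := 2) (by lia)
    (h.filter_subset_generated_union hS) (fun Q hQ => (mem_pairTraces.1 (mem_filter.1 hQ).1).2.ge)
    (fun T hT => (mem_powersetCard.1 hT).2.ge) ?_ ?_ (by rw [hcard]; exact Nat.lt_succ_of_le hone)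
    (mul_choose_lt_choose_of_threshold_le hr hn (card_powersetCard_three_le ?_) ?_)
  · have hsub : ({{1, 2}, {2, 3}} : Finset (Finset ℕ)) ⊆ powersetCard 2 (Icc 1 3) := by decide
    exact hsub.trans (powersetCard_mono (Icc_subset_Icc_right (by lia)))
  · intro F hF
    simp only [mem_generated, mem_insert, mem_singleton, exists_eq_or_imp, exists_eq_left,
      insert_subset_iff, singleton_subset_iff] at hF
    exact mem_filter.2 ⟨mem_AHM_three.2 ⟨hF.1, by tauto⟩, 2, by simp; tauto⟩
  · rw [card_singleton]
    lia
  · rwa [hcard]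

lemma pairTraces_subset_powersetCard (hk : 3 ≤ k) (h : 𝒜 ⊆ AHM n r 3) :
    pairTraces k 𝒜 ⊆ powersetCard 2 {1, 2, 3} := by
  intro P hP
  obtain ⟨hPtr, hP2⟩ := mem_pairTraces.1 hP
  obtain ⟨F, hF, rfl⟩ := mem_traces.1 hPtr
  refine mem_powersetCard.2 ⟨?_, hP2⟩
  obtain ⟨T, hT, hTF⟩ : ∃ T ∈ powersetCard 2 ({1, 2, 3} : Finset ℕ), T ⊆ F ∩ Icc 1 k := by
    have hpair {i j : ℕ} (hi : i ∈ F) (hj : j ∈ F) (hi1 : 1 ≤ i) (hij : i < j) (hj3 : j ≤ 3) :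
        ∃ T ∈ powersetCard 2 ({1, 2, 3} : Finset ℕ), T ⊆ F ∩ Icc 1 k :=
      ⟨{i, j}, mem_powersetCard.2 ⟨by grind, card_pair hij.ne⟩, by grind⟩
    obtain ⟨h1, h2⟩ | ⟨h1, h3⟩ | ⟨h2, h3⟩ := (mem_AHM_three.1 (h hF)).2
    exacts [hpair h1 h2 (by lia) (by lia) (by lia), hpair h1 h3 (by lia) (by lia) (by lia),
      hpair h2 h3 (by lia) (by lia) (by lia)]
  rw [mem_powersetCard] at hT
  rw [← eq_of_subset_of_card_le hTF (hP2.trans hT.2.symm).le]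
  exact hT.1

lemma hit_pairTraces_lt_card (hk : 3 ≤ k) (h : 𝒜 ⊆ AHM n r 3) (h1X : 1 ∉ X) (hX : X.Nonempty)
    (h23 : (X ∩ {2, 3}).Nonempty → 2 ≤ #(X \ {2, 3})) : hit X (pairTraces k 𝒜) < #X := by
  have hle : hit X (pairTraces k 𝒜) ≤ hit (X ∩ {2, 3}) (powersetCard 2 {1, 2, 3}) := by
    refine card_le_card fun P hP => ?_
    obtain ⟨hP, x, hx⟩ := mem_filter.1 hP
    have hP' := pairTraces_subset_powersetCard hk h hP
    have hxP := (mem_powersetCard.1 hP').1 (mem_inter.1 hx).1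
    exact mem_filter.2 ⟨hP', x, by grind⟩
  have htriangle : ∀ Y ⊆ ({2, 3} : Finset ℕ),
      hit Y (powersetCard 2 {1, 2, 3}) ≤ #Y + 1 := by decide
  have hzero : hit ∅ (powersetCard 2 {1, 2, 3}) = 0 := by decide
  have hcard := card_sdiff_add_card_inter X {2, 3}
  obtain hempty | hne := (X ∩ {2, 3}).eq_empty_or_nonempty
  · rw [hempty, hzero] at hle
    exact hle.trans_lt hX.card_pos
  · have := h23 hne
    have := htriangle _ (inter_subset_right (s₁ := X))
    lia

end PairTraces

section Optimal

lemma IsOptimalLCIF.card_le_hit_pairTraces (h : IsOptimalLCIF n r X 𝒜) (hr : 3 ≤ r)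
    (hn : threshold r ≤ n) (hX : X ⊆ Icc 2 n) (hS : ¬ 𝒜 ⊆ star n r) :
    #X ≤ hit X (pairTraces (2 * r) 𝒜) := by
  by_contra! hlt
  exact (h.1.hit_lt_hit_star hr hn hX hS hlt).not_ge (h.2 _ isLCIF_star)

lemma IsOptimalLCIF.eq_AHM_three (h : IsOptimalLCIF n r X 𝒜) (hr : 3 ≤ r) (hn : threshold r ≤ n)
    (hX : X ⊆ Icc 2 n) (hne : X.Nonempty) (hS : ¬ 𝒜 ⊆ star n r)
    (h23 : {2, 3} ∈ traces (2 * r) 𝒜) :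
    𝒜 = AHM n r 3 ∧ hit X (star n r) < hit X (AHM n r 3) := by
  have hn' := two_mul_add_four_le_of_threshold_le hn
  have hsub : 𝒜 ⊆ AHM n r 3 := h.1.subset_AHM_three h23
  have h1X : 1 ∉ X := fun h1 => by simpa using mem_Icc.1 (hX h1)
  obtain ⟨hmeet, hfew⟩ : (X ∩ {2, 3}).Nonempty ∧ #(X \ {2, 3}) ≤ 1 := by
    by_contra! hc
    exact (hit_pairTraces_lt_card (by lia) hsub h1X hne hc).not_ge
      (h.card_le_hit_pairTraces hr hn hX hS)
  refine ⟨hsub.antisymm ?_, hit_star_lt_hit_AHM_three hr (by lia) hX hmeet hfew⟩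
  obtain ⟨i, hi⟩ := hmeet
  rw [mem_inter] at hi
  exact h.1.AHM_three_subset_of_forall_mem (by lia) hi.2 fun F hF hiF =>
    mem_of_hit_le (fun G hG _ => hsub hG) (h.2 _ (isLCIF_AHM le_rfl)) hF
      ⟨i, mem_inter.2 ⟨hiF, hi.1⟩⟩

lemma IsOptimalLCIF.eq_AHM_of_pair_mem_traces (h : IsOptimalLCIF n r X 𝒜) (hn : r + r < n)
    {m : ℕ} (hm : m ∈ X) (hX : X ⊆ Icc 2 m) (hm3 : 3 ≤ m) (hmr : m ≤ r + 1)
    (h1m : {1, m} ∈ traces (2 * r) 𝒜) : 𝒜 = AHM n r m := by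
  have hmem : ∀ G ∈ 𝒜, (G ∩ X).Nonempty → G ∈ AHM n r m := by
    intro G hG hGX
    have hGl := h.1.subset_layer hG
    by_cases h1 : 1 ∈ G
    · exact mem_AHM_of_mem_star hX (mem_star.2 ⟨hGl, h1⟩) hGX
    · exact mem_AHM.2 ⟨hGl, Or.inr (h.1.Icc_subset_of_one_notMem h1m hG h1)⟩
  have hsub : AHM n r m ⊆ 𝒜 :=
    h.1.AHM_subset_of_forall_mem (mem_Icc.2 (by lia)) fun F hF hmF =>
      mem_of_hit_le hmem (h.2 _ (isLCIF_AHM hm3)) hF ⟨m, mem_inter.2 ⟨hmF, hm⟩⟩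
  exact (Maximal.eq_of_le (isMLCIF_AHM hm3 hmr hn) h.1 hsub).symm

lemma IsOptimalLCIF.exists_eq_AHM (h : IsOptimalLCIF n r X 𝒜) (hr : 3 ≤ r) (hn : threshold r ≤ n)
    (hX : X ⊆ Icc 2 n) (hne : X.Nonempty) (hS : ¬ 𝒜 ⊆ star n r) :
    ∃ t, 3 ≤ t ∧ t ≤ r + 1 ∧ 𝒜 = AHM n r t ∧ hit X (star n r) < hit X (AHM n r t) := by
  have hn' := two_mul_add_four_le_of_threshold_le hn
  by_cases h23 : {2, 3} ∈ traces (2 * r) 𝒜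
  · exact ⟨3, le_rfl, by lia, h.eq_AHM_three hr hn hX hne hS h23⟩
  have h1X : 1 ∉ X := fun h1 => by simpa using mem_Icc.1 (hX h1)
  obtain ⟨m, hm, hmax⟩ : ∃ m ∈ X, ∀ x ∈ X, x ≤ m := X.exists_max_image id hne
  have hXm : X ⊆ Icc 2 m := fun x hx => mem_Icc.2 ⟨(mem_Icc.1 (hX hx)).1, hmax x hx⟩
  have h1m : {1, m} ∈ traces (2 * r) 𝒜 :=
    h.1.pair_one_mem_traces h23 h1X (h.card_le_hit_pairTraces hr hn hX hS) hm
  have hm3 : 3 ≤ m := by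
    refine (Nat.lt_or_eq_of_le (mem_Icc.1 (hX hm)).1).resolve_right fun hm2 => ?_
    obtain rfl : X = {2} := hne.subset_singleton_iff.1 (hXm.trans (by rw [← hm2]; simp))
    exact (h.1.hit_singleton_two_lt_hit_AHM_three hr hn hS h23).not_ge (h.2 _ (isLCIF_AHM le_rfl))
  have hmr : m ≤ r + 1 := by
    obtain ⟨G, hG, hGS⟩ := not_subset.1 hS
    have hGl := h.1.subset_layer hG
    have := card_le_card
      (h.1.Icc_subset_of_one_notMem h1m hG fun h1 => hGS (mem_star.2 ⟨hGl, h1⟩))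
    rw [(mem_layer.1 hGl).2, Nat.card_Icc] at this
    lia
  exact ⟨m, hm3, hmr, h.eq_AHM_of_pair_mem_traces (by lia) hm hXm hm3 hmr h1m,
    hit_star_lt_hit_AHM hmr (by lia) hXm hne⟩

lemma IsOptimalLCIF.subset_star (h : IsOptimalLCIF n r X 𝒜) (hS : IsOptimalLCIF n r X (star n r))
    (hr : 3 ≤ r) (hn : threshold r ≤ n) (hX : X ⊆ Icc 2 n) (hne : X.Nonempty) : 𝒜 ⊆ star n r := by
  by_contra h𝒜
  obtain ⟨t, -, -, rfl, hlt⟩ := h.exists_eq_AHM hr hn hX hne h𝒜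
  exact hlt.not_ge (hS.2 _ h.1)

lemma IsOptimalLCIF.lt_of_subset_Icc (h : IsOptimalLCIF n r X (star n r)) (hr : 3 ≤ r)
    (hn : r + 1 < n) {m : ℕ} (hne : X.Nonempty) (hX : X ⊆ Icc 2 m) : r + 1 < m := by
  by_contra! hmr
  obtain hm3 | hm2 := le_or_gt 3 m
  · exact (hit_star_lt_hit_AHM hmr (by lia) hX hne).not_ge (h.2 _ (isLCIF_AHM hm3))
  · obtain rfl : X = {2} := by
      refine hne.subset_singleton_iff.1 (hX.trans fun x hx => ?_)
      rw [mem_Icc] at hx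
      exact mem_singleton.2 (by lia)
    exact (hit_star_lt_hit_AHM_three hr (by lia) (by simp; lia) (by decide) (by decide)).not_ge
      (h.2 _ (isLCIF_AHM le_rfl))

lemma IsOptimalLCIF.AHM_subset_of_subset_star (h : IsOptimalLCIF n r X 𝒜) (hS : 𝒜 ⊆ star n r)
    (ht : t ∈ Icc 2 n) (htX : t ∈ X) (htr : r + 1 < t) : AHM n r t ⊆ 𝒜 :=
  h.1.AHM_subset_of_forall_mem ht fun _ hF htF =>
    mem_of_hit_le (fun _ hG _ => hS hG) (h.2 _ isLCIF_star) (AHM_subset_star htr hF)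
      ⟨t, mem_inter.2 ⟨htF, htX⟩⟩

end Optimal

end LCIF

theorem corollary3p3 (r : ℕ) (hr : 3 ≤ r) :
    ∃ N : ℕ, ∀ n : ℕ, N ≤ n → ∀ (X : Finset ℕ) (hX : X.Nonempty), X ⊆ Finset.Icc 2 n →
      (¬ LCIF.IsOptimalMLCIF n r X (LCIF.star n r) →
        ∀ 𝒜 : Finset (Finset ℕ),
          LCIF.IsOptimalLCIF n r X 𝒜 ↔ LCIF.IsOptimalMLCIF n r X 𝒜) ∧
      (LCIF.IsOptimalMLCIF n r X (LCIF.star n r) →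
        ∀ 𝒜 : Finset (Finset ℕ),
          LCIF.IsOptimalLCIF n r X 𝒜 ↔
            LCIF.IsLCIF n r 𝒜 ∧ LCIF.AHM n r (X.max' hX) ⊆ 𝒜 ∧ 𝒜 ⊆ LCIF.star n r) := by
  refine ⟨LCIF.threshold r, fun n hn X hne hX => ?_⟩
  have hn' := LCIF.two_mul_add_four_le_of_threshold_le hn
  constructor
  · refine fun hS 𝒜 => ⟨fun h => ⟨?_, fun ℱ hℱ => h.2 ℱ hℱ.prop⟩,
      LCIF.IsOptimalMLCIF.isOptimalLCIF⟩
    by_cases hAS : 𝒜 ⊆ LCIF.star n r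
    · exact absurd ⟨LCIF.isMLCIF_star (by lia) (by lia),
        fun ℱ hℱ => (h.2 ℱ hℱ.prop).trans (LCIF.hit_mono hAS)⟩ hS
    · obtain ⟨t, ht, htr, rfl, -⟩ := h.exists_eq_AHM hr hn hX hne hAS
      exact LCIF.isMLCIF_AHM ht htr (by lia)
  · intro hS 𝒜
    have hS' := hS.isOptimalLCIF
    have hXm : X ⊆ Icc 2 (X.max' hne) := fun x hx =>
      mem_Icc.2 ⟨(mem_Icc.1 (hX hx)).1, X.le_max' x hx⟩
    constructor
    · intro h
      have hAS : 𝒜 ⊆ LCIF.star n r := h.subset_star hS' hr hn hX hne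
      exact ⟨h.1, h.AHM_subset_of_subset_star hAS (hX (X.max'_mem hne)) (X.max'_mem hne)
        (hS'.lt_of_subset_Icc hr (by lia) hne hXm), hAS⟩
    · rintro ⟨hA, hAHM, -⟩
      exact ⟨hA, fun ℱ hℱ => (hS'.2 ℱ hℱ).trans (LCIF.hit_star_le_hit_of_AHM_subset hXm hAHM)⟩
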